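/- Let $X=\mathbb{R}^d$ with the Euclidean norm, let $\Phi_1,\dots,\Phi_N:X\to\mathbb{R}$ ($N\ge 1$) be continuously differentiable, let $\bar\Phi=\frac1N\sum_{i=1}^N\Phi_i$, and assume that every gradient $\nabla\Phi_i$ is Lipschitz continuous with constant $L\ge 0$. Let $(W_t)_{t\ge 0}$ be a standard Brownian motion on $X$ and let $(\boldsymbol{i}(t))_{t\ge 0}$ be a homogeneous continuous-time Markov process on $\{1,\dots,N\}$, independent of $W$, with right-continuous paths and arbitrary initial law, that jumps from any state to any other state at rate $1$. Fix a deterministic initial value $\theta_0\in X$. Let $(\zeta_t)_{t\ge 0}$ be the Langevin diffusion, i.e. the strong solution of $$\mathrm{d}\zeta_t=-\nabla\bar\Phi(\zeta_t)\,\mathrm{d}t+\sqrt2\,\mathrm{d}W_t,\qquad \zeta_0=\theta_0,$$ and, for $\eta>0$, let $(\theta^\eta_t)_{t\ge 0}$ be the stochastic gradient Langevin diffusion (SGLDiff), i.e. the strong solution, with the same Brownian motion $W$ and the same initial value, of $$\mathrm{d}\theta^\eta_t=-\nabla\Phi_{\boldsymbol{i}(t/\eta)}(\theta^\eta_t)\,\mathrm{d}t+\sqrt2\,\mathrm{d}W_t,\qquad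 \theta^\eta_0=\theta_0.$$ Then, for every $\eta>0$ and every $t\ge 0$, $\|\theta^\eta_t-\zeta_t\|$ is integrable and $$\mathbb{E}\big[\|\theta^\eta_t-\zeta_t\|\big]\le C_{\Phi,\theta_0,d}\;\mathrm{e}^{8(1+L)t}\,\eta^{1/4},$$ where $$C_{\Phi,\theta_0,d}=8\big(1+d+\|\theta_0\|^2+2\|\nabla\bar\Phi(0)\|^2\big)^{1/2}\Big(1+L+\sup_{1\le i\le N}\|\nabla\Phi_i(0)\|\Big).$$ As an expression in $d$, with $\|\theta_0\|$, $\|\nabla\bar\Phi(0)\|$, $L$ and $\sup_i\|\nabla\Phi_i(0)\|$ held fixed, this constant is of exact order $\sqrt d$ as $d\to\infty$. Consequently the two processes converge strongly at each fixed time: for every $t\ge 0$, $\mathbb{E}[\|\theta^\eta_t-\zeta_t\|]\to 0$ as $\eta\downarrow 0$. -/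

import Mathlib

open MeasureTheory ProbabilityTheory Filter Topology
open scoped NNReal

noncomputable section

namespace SGLDiff

/-- The σ-algebra generated by the process `X` up to and including time `t`. -/
@[reducible] def past {Ω E : Type*} [MeasurableSpace E] (X : ℝ≥0 → Ω → E) (t : ℝ≥0) : MeasurableSpace Ω :=
  ⨆ s : Set.Iic t, MeasurableSpace.comap (X s) inferInstance

/-- A standard Brownian motion on `ℝ^d`, started at `0`: its coordinates are independent
real Brownian motions. -/
structure IsBrownian {Ω : Type*} [MeasurableSpace Ω] (P : Measure Ω) {d : ℕ}
    (W : ℝ≥0 → Ω → EuclideanSpace ℝ (Fin d)) : Prop where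
  measurable : ∀ t, Measurable (W t)
  coord : ∀ k : Fin d, IsBrownianReal (fun t ω => W t ω k) P
  indep : iIndepFun (fun (k : Fin d) (ω : Ω) (t : ℝ≥0) => W t ω k) P

/-- The jump-rate matrix on `N` states with rate `1` from every state to every other state. -/
def rateMatrix (N : ℕ) : Matrix (Fin N) (Fin N) ℝ :=
  Matrix.of fun a b => if a = b then -((N : ℝ) - 1) else 1

/-- `J` is a homogeneous continuous-time Markov process on `N` states (with right-continuous
paths and arbitrary initial law) that jumps from any state to any other state at rate `1`:
conditionally on the past up to time `s` and on `J s = a`, the state at time `s + t` is `b` with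
probability `exp (t Q) a b`, where `Q` is the rate matrix. -/
structure IsIndexProcess {Ω : Type*} [MeasurableSpace Ω] (P : Measure Ω) {N : ℕ}
    (J : ℝ≥0 → Ω → Fin N) : Prop where
  measurable : ∀ t, Measurable (J t)
  rightContinuous : ∀ᵐ ω ∂P, ∀ t : ℝ≥0, ContinuousWithinAt (fun s => J s ω) (Set.Ici t) t
  markov : ∀ (s t : ℝ≥0) (A : Set Ω), MeasurableSet[past J s] A → ∀ a b : Fin N,
    P.real (A ∩ J s ⁻¹' {a} ∩ J (s + t) ⁻¹' {b}) =
      P.real (A ∩ J s ⁻¹' {a}) * NormedSpace.exp ((t : ℝ) • rateMatrix N) a b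

/-- `X` is a strong solution of `dX_t = b(t, X_t) dt + √2 dW_t`, `X_0 = x₀`, where the drift `b`
may depend on `ω`: `X` has continuous paths, is adapted to the `P`-completion of `F`, and almost
surely satisfies the integrated equation at all times. -/
structure IsSolution {Ω : Type*} [MeasurableSpace Ω] (P : Measure Ω) {d : ℕ}
    (W : ℝ≥0 → Ω → EuclideanSpace ℝ (Fin d)) (F : ℝ≥0 → MeasurableSpace Ω)
    (b : ℝ≥0 → Ω → EuclideanSpace ℝ (Fin d) → EuclideanSpace ℝ (Fin d))
    (x₀ : EuclideanSpace ℝ (Fin d)) (X : ℝ≥0 → Ω → EuclideanSpace ℝ (Fin d)) : Prop where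
  adapted : ∀ t, AEStronglyMeasurable[F t] (X t) P
  continuous : ∀ᵐ ω ∂P, Continuous fun t => X t ω
  equation : ∀ᵐ ω ∂P, ∀ t : ℝ≥0,
    X t ω = x₀ + (∫ s in (0 : ℝ)..t, b s.toNNReal ω (X s.toNNReal ω)) + √2 • W t ω

/-- The arithmetic mean of the potentials `Φ i`. -/
def meanPotential {d N : ℕ} (Φ : Fin N → EuclideanSpace ℝ (Fin d) → ℝ)
    (x : EuclideanSpace ℝ (Fin d)) : ℝ :=
  1 / (N : ℝ) * ∑ i, Φ i x

/-- `ζ` solves the Langevin equation `dζ_t = -∇Φ̄(ζ_t) dt + √2 dW_t`, `ζ_0 = x₀`. -/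
def IsLangevin {Ω : Type*} [MeasurableSpace Ω] (P : Measure Ω) {d N : ℕ}
    (Φ : Fin N → EuclideanSpace ℝ (Fin d) → ℝ) (W : ℝ≥0 → Ω → EuclideanSpace ℝ (Fin d))
    (x₀ : EuclideanSpace ℝ (Fin d)) (ζ : ℝ≥0 → Ω → EuclideanSpace ℝ (Fin d)) : Prop :=
  IsSolution P W (fun t => past W t) (fun _ _ x => -gradient (meanPotential Φ) x) x₀ ζ

/-- `θ` solves the switched equation `dθ_t = -∇Φ_{J(t/η)}(θ_t) dt + √2 dW_t`, `θ_0 = x₀`. -/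
def IsSGLDiff {Ω : Type*} [MeasurableSpace Ω] (P : Measure Ω) {d N : ℕ}
    (Φ : Fin N → EuclideanSpace ℝ (Fin d) → ℝ) (W : ℝ≥0 → Ω → EuclideanSpace ℝ (Fin d))
    (J : ℝ≥0 → Ω → Fin N) (η : ℝ≥0)
    (x₀ : EuclideanSpace ℝ (Fin d)) (θ : ℝ≥0 → Ω → EuclideanSpace ℝ (Fin d)) : Prop :=
  IsSolution P W (fun t => past W t ⊔ past J (t / η))
    (fun t ω x => -gradient (Φ (J (t / η) ω)) x) x₀ θ

/-- The constant `8 (1 + d + r² + 2 g²)^{1/2} (1 + L + G)`. -/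
def errorConst (d : ℕ) (L r g G : ℝ) : ℝ :=
  8 * √(1 + (d : ℝ) + r ^ 2 + 2 * g ^ 2) * (1 + L + G)

end SGLDiff

end

/-!
The two diffusions are driven by the same noise, so their difference `D = θ - ζ` satisfies an
ordinary integral equation. Write `f i = ∇Φ i - ∇Φ̄`, which sums to zero over `i`. Adding and
subtracting the switched drift along `ζ`, pathwise
`‖D t‖ ≤ ‖R t‖ + L ∫₀ᵗ ‖D‖`, where `R t = ∫₀ᵗ f (J (s / η)) (ζ s) ds`,
and Grönwall's inequality (`le_add_mul_integral_of_le_add_integral`) reduces everything to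
`E‖R t‖`. The point of evaluating the switching error along `ζ` and not along `θ` is that `ζ` is a
functional of `W`, hence independent of `J`.

By this independence the correlation `E⟪f (J q) (ζ u), f (J p) (ζ r)⟫`, `p ≤ q`, is a sum over states
of transition probabilities times expectations in `ζ` alone. Vectors of sum zero are eigenvectors
of the rate matrix with eigenvalue `-N` (`rateMatrix_mulVec`), so the correlation is at most
`exp (-(q - p))` times a second moment (`integral_inner_switched_le`). Integrating over
`p = r / η`, `q = u / η` gives `E‖R t‖² ≤ t C min (2 η, t)`
(`integral_norm_sq_integral_switched_le`), and the minimum is at most of order `η ^ (1 / 2)`, which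
is the square of the claimed rate. No modulus of continuity of `ζ` enters.

The constant `C` comes from the second moments of `ζ` and the linear growth of `f i`. The moments
are obtained without Itô's formula: Grönwall bounds the path of `ζ` by that of `W`
(`IsSolution.integral_norm_sq_le`). Right-continuity of `J` and continuity of `ζ` make the processes
jointly measurable up to null sets (`aestronglyMeasurable_uncurry_of_rightContinuous`), as Fubini's
theorem requires.
-/

namespace SGLDiff

/-! ### The transition semigroup of the index process -/

section MatrixExp

attribute [local instance] Matrix.linftyOpNormedRing Matrix.linftyOpNormedAlgebra

theorem exp_mulVec_of_mulVec_eq_smul {n : Type*} [Fintype n] [DecidableEq n]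
    {A : Matrix n n ℝ} {v : n → ℝ} {c : ℝ} (h : A.mulVec v = c • v) :
    (NormedSpace.exp A).mulVec v = Real.exp c • v := by
  have hpow : ∀ k : ℕ, (A ^ k).mulVec v = c ^ k • v := by
    intro k
    induction k with
    | zero => simp
    | succ k ih => rw [pow_succ, ← Matrix.mulVec_mulVec, h, Matrix.mulVec_smul, ih, smul_smul,
        pow_succ']
  have h1 := NormedSpace.exp_series_hasSum_exp' (𝕂 := ℝ) A
  let φ : Matrix n n ℝ →ₗ[ℝ] (n → ℝ) :=
    { toFun := fun B => B.mulVec v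
      map_add' := fun B C => Matrix.add_mulVec B C v
      map_smul' := fun a B => Matrix.smul_mulVec a B v }
  have hφ : Continuous φ := φ.continuous_of_finiteDimensional
  have h2 := h1.map φ hφ
  have h3 := (NormedSpace.exp_series_hasSum_exp' (𝕂 := ℝ) c).smul_const v
  rw [← Real.exp_eq_exp_ℝ] at h3
  refine h2.unique ?_
  convert h3 using 2 with k
  simp only [Function.comp_apply, map_smul, smul_eq_mul, ← smul_smul]
  exact congrArg _ (hpow k)

end MatrixExp

theorem rateMatrix_mulVec {N : ℕ} {v : Fin N → ℝ} (hv : ∑ b, v b = 0) :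
    (rateMatrix N).mulVec v = -(N : ℝ) • v := by
  funext a
  have h : ∀ b, rateMatrix N a b * v b = v b - if a = b then (N : ℝ) * v b else 0 := by
    intro b
    by_cases hab : a = b
    · simp [rateMatrix, hab]; ring
    · simp [rateMatrix, hab]
  simp [Matrix.mulVec, dotProduct, h, Finset.sum_sub_distrib, hv]

/-- The semigroup generated by `rateMatrix N` contracts mean-zero vectors at rate `N`. -/
theorem sum_exp_rateMatrix_mul {N : ℕ} {v : Fin N → ℝ} (hv : ∑ b, v b = 0) (t : ℝ) (a : Fin N) :
    ∑ b, NormedSpace.exp (t • rateMatrix N) a b * v b = Real.exp (-(N : ℝ) * t) * v a := by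
  have h : (t • rateMatrix N).mulVec v = (-(N : ℝ) * t) • v := by
    rw [Matrix.smul_mulVec, rateMatrix_mulVec hv, smul_smul, mul_comm]
  exact congrFun (exp_mulVec_of_mulVec_eq_smul h) a

/-! ### Joint measurability of right-continuous processes -/

theorem aestronglyMeasurable_uncurry_of_rightContinuous {Ω E : Type*} [MeasurableSpace Ω]
    {P : Measure Ω} [SFinite P] [TopologicalSpace E] [TopologicalSpace.PseudoMetrizableSpace E]
    {X : ℝ → Ω → E} (hX : ∀ t, AEStronglyMeasurable (X t) P)
    (hc : ∀ᵐ ω ∂P, ∀ t, ContinuousWithinAt (fun s => X s ω) (Set.Ici t) t)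
    (μ : Measure ℝ) [SFinite μ] :
    AEStronglyMeasurable (fun p : ℝ × Ω => X p.1 p.2) (μ.prod P) := by
  -- `u ↦ (⌊(n + 1) u⌋ + 1) / (n + 1)` is a step function decreasing to the identity from above
  let τ : ℕ → ℝ → ℝ := fun n u => ((⌊((n : ℝ) + 1) * u⌋ : ℝ) + 1) / ((n : ℝ) + 1)
  have hτ0 : ∀ n u, u ≤ τ n u := by
    intro n u
    have h : (0 : ℝ) < (n : ℝ) + 1 := by positivity
    rw [le_div_iff₀ h, mul_comm]
    exact (Int.lt_floor_add_one _).le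
  have hτ1 : ∀ n u, τ n u ≤ u + 1 / ((n : ℝ) + 1) := by
    intro n u
    have h : (0 : ℝ) < (n : ℝ) + 1 := by positivity
    have h3 : τ n u = (⌊((n : ℝ) + 1) * u⌋ : ℝ) / ((n : ℝ) + 1) + 1 / ((n : ℝ) + 1) := add_div _ _ _
    rw [h3]
    gcongr
    rw [div_le_iff₀ h, mul_comm u]
    exact Int.floor_le _
  have hτ : ∀ u, Tendsto (fun n => τ n u) atTop (𝓝[≥] u) := by
    intro u
    refine tendsto_nhdsWithin_iff.2 ⟨?_, Eventually.of_forall fun n => hτ0 n u⟩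
    refine tendsto_of_tendsto_of_tendsto_of_le_of_le tendsto_const_nhds ?_
      (fun n => hτ0 n u) (fun n => hτ1 n u)
    simpa using tendsto_one_div_add_atTop_nhds_zero_nat.const_add u
  refine aestronglyMeasurable_of_tendsto_ae (u := atTop)
    (f := fun n (p : ℝ × Ω) => X (τ n p.1) p.2) ?_ ?_
  · intro n
    let S : ℤ → Set (ℝ × Ω) := fun k => {p | ⌊((n : ℝ) + 1) * p.1⌋ = k}
    have hS : ∀ k, MeasurableSet (S k) := fun k =>
      (Int.measurable_floor.comp (measurable_fst.const_mul ((n : ℝ) + 1)))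
        (measurableSet_singleton k)
    have hU : ⋃ k, S k = Set.univ := by
      ext p
      simp [S]
    rw [← Measure.restrict_univ (μ := μ.prod P), ← hU, aestronglyMeasurable_iUnion_iff]
    intro k
    have h1 : AEStronglyMeasurable (fun p : ℝ × Ω => X (((k : ℝ) + 1) / ((n : ℝ) + 1)) p.2)
        (μ.prod P) := (hX _).comp_snd
    refine h1.restrict.congr ?_
    filter_upwards [ae_restrict_mem (hS k)] with p hp
    have hp' : ⌊((n : ℝ) + 1) * p.1⌋ = k := hp
    simp only [τ, hp']
  · have h2 : ∀ᵐ p ∂(μ.prod P), ∀ t, ContinuousWithinAt (fun s => X s p.2) (Set.Ici t) t :=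
      Measure.quasiMeasurePreserving_snd.ae hc
    filter_upwards [h2] with p hp
    exact (hp p.1).tendsto.comp (hτ p.1)

/-! ### Real-variable estimates -/

/-- Integral Grönwall inequality with a variable inhomogeneity. -/
theorem le_add_mul_integral_of_le_add_integral {v ρ : ℝ → ℝ} {L T : ℝ} (hv : Continuous v)
    (hρ : Continuous ρ) (hρ0 : ∀ s, 0 ≤ ρ s) (hL : 0 ≤ L) (hT : 0 ≤ T)
    (h : ∀ s ∈ Set.Icc 0 T, v s ≤ ρ s + L * ∫ u in (0 : ℝ)..s, v u) :
    v T ≤ ρ T + L * (Real.exp (L * T) * ∫ u in (0 : ℝ)..T, ρ u) := by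
  -- `z` is antitone, since `exp (-L s) (v - L ∫ v) ≤ exp (-L s) ρ ≤ ρ`
  let z : ℝ → ℝ := fun s =>
    Real.exp (-(L * s)) * (∫ u in (0 : ℝ)..s, v u) - ∫ u in (0 : ℝ)..s, ρ u
  have hz : ∀ s, HasDerivAt z (Real.exp (-(L * s)) * -L * (∫ u in (0 : ℝ)..s, v u) +
      Real.exp (-(L * s)) * v s - ρ s) s := by
    intro s
    have h1 : HasDerivAt (fun s : ℝ => Real.exp (-(L * s))) (Real.exp (-(L * s)) * -L) s := by
      have := ((hasDerivAt_id s).const_mul L).neg.exp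
      simpa using this
    exact (h1.mul (hv.integral_hasStrictDerivAt 0 s).hasDerivAt).sub
      (hρ.integral_hasStrictDerivAt 0 s).hasDerivAt
  have hanti : AntitoneOn z (Set.Icc 0 T) := by
    refine antitoneOn_of_deriv_nonpos (convex_Icc 0 T)
      (fun s _ => (hz s).continuousAt.continuousWithinAt)
      (fun s _ => (hz s).differentiableAt.differentiableWithinAt) ?_
    intro s hs
    rw [interior_Icc] at hs
    rw [(hz s).deriv]
    have hs' := h s ⟨hs.1.le, hs.2.le⟩
    have he0 : 0 < Real.exp (-(L * s)) := Real.exp_pos _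
    have he1 : Real.exp (-(L * s)) ≤ 1 :=
      Real.exp_le_one_iff.2 (neg_nonpos.2 (mul_nonneg hL hs.1.le))
    nlinarith [hρ0 s]
  have h0 : z T ≤ z 0 := hanti ⟨le_rfl, hT⟩ ⟨hT, le_rfl⟩ hT
  have h1 : z 0 = 0 := by simp [z]
  rw [h1, sub_nonpos] at h0
  have h2 : (∫ u in (0 : ℝ)..T, v u) ≤ Real.exp (L * T) * ∫ u in (0 : ℝ)..T, ρ u := by
    have := mul_le_mul_of_nonneg_left h0 (Real.exp_pos (L * T)).le
    rwa [← mul_assoc, ← Real.exp_add, add_neg_cancel, Real.exp_zero, one_mul] at this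
  linarith [h T ⟨hT, le_rfl⟩, mul_le_mul_of_nonneg_left h2 hL]

theorem sq_intervalIntegral_le {f : ℝ → ℝ} {T : ℝ} (hT : 0 ≤ T)
    (hf : IntervalIntegrable f volume 0 T)
    (hf2 : IntervalIntegrable (fun s => f s ^ 2) volume 0 T) :
    (∫ s in (0 : ℝ)..T, f s) ^ 2 ≤ T * ∫ s in (0 : ℝ)..T, f s ^ 2 := by
  rcases hT.eq_or_lt with rfl | hT'
  · simp
  set m := ∫ s in (0 : ℝ)..T, f s with hm
  -- the variance of `f` on `[0, T]` is nonnegative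
  have h0 : 0 ≤ ∫ s in (0 : ℝ)..T, (T * f s - m) ^ 2 :=
    intervalIntegral.integral_nonneg hT fun s _ => sq_nonneg _
  have h1 : (∫ s in (0 : ℝ)..T, (T * f s - m) ^ 2) =
      T ^ 2 * (∫ s in (0 : ℝ)..T, f s ^ 2) - 2 * T * m * m + T * m ^ 2 := by
    have : ∀ s, (T * f s - m) ^ 2 = T ^ 2 * f s ^ 2 - 2 * T * m * f s + m ^ 2 := fun s => by ring
    simp_rw [this]
    rw [intervalIntegral.integral_add ((hf2.const_mul _).sub (hf.const_mul _))
      intervalIntegrable_const, intervalIntegral.integral_sub (hf2.const_mul _) (hf.const_mul _),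
      intervalIntegral.integral_const_mul, intervalIntegral.integral_const_mul, ← hm]
    simp
  rw [h1] at h0
  have h2 : 0 ≤ T * (T * (∫ s in (0 : ℝ)..T, f s ^ 2) - m ^ 2) := by linarith
  linarith [nonneg_of_mul_nonneg_right h2 hT']

theorem intervalIntegral_exp_neg_abs_sub_le {c T : ℝ} (hc : 0 < c) (hT : 0 ≤ T) (u : ℝ) :
    ∫ r in (0 : ℝ)..T, Real.exp (-(c * |u - r|)) ≤ 2 / c := by
  have hval : ∫ r, Real.exp (-(c * |r|)) = 2 / c := by
    rw [integral_comp_abs (f := fun r => Real.exp (-(c * r)))]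
    have := integral_exp_mul_Ioi (a := -c) (by linarith) 0
    simp only [neg_mul] at this
    rw [this]
    simp [div_eq_mul_inv]
  have hI : Integrable (fun r : ℝ => Real.exp (-(c * |r|))) :=
    Integrable.of_integral_ne_zero (by rw [hval]; positivity)
  have hI' : Integrable (fun r : ℝ => Real.exp (-(c * |u - r|))) := hI.comp_sub_left u
  rw [intervalIntegral.integral_of_le hT]
  calc ∫ r in Set.Ioc 0 T, Real.exp (-(c * |u - r|))
      ≤ ∫ r, Real.exp (-(c * |u - r|)) :=
        setIntegral_le_integral hI' (Eventually.of_forall fun r => (Real.exp_pos _).le)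
    _ = ∫ r, Real.exp (-(c * |r|)) :=
        integral_sub_left_eq_self (fun r => Real.exp (-(c * |r|))) volume u
    _ = 2 / c := hval

/-! ### Moments of time integrals -/

section TimeIntegral

variable {Ω : Type*} [MeasurableSpace Ω] {P : Measure Ω} [IsProbabilityMeasure P]

theorem integrable_prod_of_integral_norm_le {E : Type*} [NormedAddCommGroup E] {X : ℝ → Ω → E}
    {T C : ℝ}
    (hm : AEStronglyMeasurable (fun p : ℝ × Ω => X p.1 p.2) ((volume.restrict (Set.Ioc 0 T)).prod P))
    (hi : ∀ s ∈ Set.Ioc 0 T, Integrable (X s) P)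
    (hC : ∀ s ∈ Set.Ioc 0 T, ∫ ω, ‖X s ω‖ ∂P ≤ C) :
    Integrable (fun p : ℝ × Ω => X p.1 p.2) ((volume.restrict (Set.Ioc 0 T)).prod P) := by
  rw [integrable_prod_iff hm]
  refine ⟨?_, ?_⟩
  · filter_upwards [ae_restrict_mem measurableSet_Ioc] with s hs using hi s hs
  · refine Integrable.mono' (integrable_const C) hm.norm.integral_prod_right' ?_
    filter_upwards [ae_restrict_mem measurableSet_Ioc] with s hs
    rw [Real.norm_of_nonneg (integral_nonneg fun ω => norm_nonneg _)]
    exact hC s hs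

theorem integral_intervalIntegral_le {X : ℝ → Ω → ℝ} {T C : ℝ} (hT : 0 ≤ T)
    (hm : AEStronglyMeasurable (fun p : ℝ × Ω => X p.1 p.2) ((volume.restrict (Set.Ioc 0 T)).prod P))
    (h0 : ∀ s ω, 0 ≤ X s ω)
    (hi : ∀ s ∈ Set.Ioc 0 T, Integrable (X s) P)
    (hC : ∀ s ∈ Set.Ioc 0 T, ∫ ω, X s ω ∂P ≤ C) :
    Integrable (fun ω => ∫ s in (0 : ℝ)..T, X s ω) P ∧
      ∫ ω, (∫ s in (0 : ℝ)..T, X s ω) ∂P ≤ T * C := by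
  have hI := integrable_prod_of_integral_norm_le hm hi
    (by simpa only [Real.norm_of_nonneg (h0 _ _)] using hC)
  simp only [intervalIntegral.integral_of_le hT]
  refine ⟨hI.integral_prod_right, ?_⟩
  rw [← integral_integral_swap (f := X) (by exact hI)]
  calc ∫ s in Set.Ioc 0 T, ∫ ω, X s ω ∂P ≤ ∫ s in Set.Ioc 0 T, C :=
        setIntegral_mono_on hI.integral_prod_left (integrable_const C) measurableSet_Ioc hC
    _ = T * C := by simp [hT]

/-- If every `E⟪X u, ∫ X⟫ = ∫ E⟪X u, X r⟫ dr` is at most `B`, then `E‖∫₀ᵀ X‖² ≤ T B`. -/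
theorem integral_norm_sq_intervalIntegral_le {E : Type*} [NormedAddCommGroup E]
    [InnerProductSpace ℝ E] [CompleteSpace E] {X : ℝ → Ω → E} {T C B : ℝ} (hT : 0 ≤ T)
    (hm : AEStronglyMeasurable (fun p : ℝ × Ω => X p.1 p.2) ((volume.restrict (Set.Ioc 0 T)).prod P))
    (hX : ∀ s ∈ Set.Ioc 0 T, MemLp (X s) 2 P)
    (hC : ∀ s ∈ Set.Ioc 0 T, ∫ ω, ‖X s ω‖ ^ 2 ∂P ≤ C)
    (hB : ∀ u ∈ Set.Ioc 0 T, ∫ r in (0 : ℝ)..T, (∫ ω, inner ℝ (X u ω) (X r ω) ∂P) ≤ B) :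
    Integrable (fun ω => ‖∫ s in (0 : ℝ)..T, X s ω‖ ^ 2) P ∧
      ∫ ω, ‖∫ s in (0 : ℝ)..T, X s ω‖ ^ 2 ∂P ≤ T * B := by
  simp only [intervalIntegral.integral_of_le hT] at hB ⊢
  set μ : Measure ℝ := volume.restrict (Set.Ioc 0 T) with hμ
  have hnn : ∀ s ω, 0 ≤ ‖X s ω‖ ^ 2 := fun s ω => by positivity
  have hi2 : ∀ s ∈ Set.Ioc 0 T, Integrable (fun ω => ‖X s ω‖ ^ 2) P := fun s hs =>
    (hX s hs).integrable_norm_pow two_ne_zero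
  have hI2 : Integrable (fun p : ℝ × Ω => ‖X p.1 p.2‖ ^ 2) (μ.prod P) :=
    integrable_prod_of_integral_norm_le (X := fun s ω => ‖X s ω‖ ^ 2) (hm.norm.pow 2) hi2
      (by simpa only [Real.norm_of_nonneg (hnn _ _)] using hC)
  have hI1 : Integrable (fun p : ℝ × Ω => X p.1 p.2) (μ.prod P) := by
    refine Integrable.mono' (hI2.add (integrable_const 1)) hm (Eventually.of_forall fun p => ?_)
    have : ‖X p.1 p.2‖ ≤ ‖X p.1 p.2‖ ^ 2 + 1 := by nlinarith [sq_nonneg (‖X p.1 p.2‖ - 1)]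
    exact this
  have hR1 : Integrable (fun ω => ∫ s, X s ω ∂μ) P := hI1.integral_prod_right
  have hR2 : Integrable (fun ω => ‖∫ s, X s ω ∂μ‖ ^ 2) P := by
    refine Integrable.mono' (hI2.integral_prod_right.const_mul T)
      (hR1.aestronglyMeasurable.norm.pow 2) ?_
    filter_upwards [hI1.prod_left_ae, hI2.prod_left_ae] with ω h1 h2
    rw [Real.norm_of_nonneg (by positivity)]
    have h3 := sq_intervalIntegral_le (f := fun s => ‖X s ω‖) hT
      ((intervalIntegrable_iff_integrableOn_Ioc_of_le hT).2 h1.norm)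
      ((intervalIntegrable_iff_integrableOn_Ioc_of_le hT).2 h2)
    rw [intervalIntegral.integral_of_le hT, intervalIntegral.integral_of_le hT] at h3
    exact (pow_le_pow_left₀ (norm_nonneg _) (norm_integral_le_integral_norm _) 2).trans h3
  refine ⟨hR2, ?_⟩
  -- the square is expanded one time integral at a time, so Fubini is only needed on `ℝ × Ω`
  have hinner : ∀ x y : E, ‖inner ℝ x y‖ ≤ ‖x‖ ^ 2 + ‖y‖ ^ 2 := fun x y => by
    have := norm_inner_le_norm (𝕜 := ℝ) x y
    nlinarith [sq_nonneg (‖x‖ - ‖y‖), sq_nonneg ‖x‖, sq_nonneg ‖y‖]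
  have hIR : Integrable (fun p : ℝ × Ω => inner ℝ (X p.1 p.2) (∫ r, X r p.2 ∂μ)) (μ.prod P) :=
    Integrable.mono' (hI2.add (hR2.comp_snd μ)) (hm.inner hR1.aestronglyMeasurable.comp_snd)
      (Eventually.of_forall fun p => hinner _ _)
  have h1 : ∫ ω, ‖∫ s, X s ω ∂μ‖ ^ 2 ∂P =
      ∫ ω, (∫ u, inner ℝ (X u ω) (∫ r, X r ω ∂μ) ∂μ) ∂P := by
    refine integral_congr_ae ?_
    filter_upwards [hI1.prod_left_ae] with ω hω
    rw [← real_inner_self_eq_norm_sq, ← integral_inner hω]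
    simp_rw [real_inner_comm]
  rw [h1, ← integral_integral_swap (f := fun u ω => inner ℝ (X u ω) (∫ r, X r ω ∂μ))
    (by exact hIR)]
  calc ∫ u, (∫ ω, inner ℝ (X u ω) (∫ r, X r ω ∂μ) ∂P) ∂μ ≤ ∫ u, B ∂μ := by
        refine setIntegral_mono_on hIR.integral_prod_left (integrable_const B)
          measurableSet_Ioc fun u hu => ?_
        have hIu : Integrable (fun p : ℝ × Ω => inner ℝ (X u p.2) (X p.1 p.2)) (μ.prod P) :=
          Integrable.mono' (((hi2 u hu).comp_snd μ).add hI2)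
            ((hX u hu).aestronglyMeasurable.comp_snd.inner hm)
            (Eventually.of_forall fun p => hinner _ _)
        have h2 : ∫ ω, inner ℝ (X u ω) (∫ r, X r ω ∂μ) ∂P =
            ∫ ω, (∫ r, inner ℝ (X u ω) (X r ω) ∂μ) ∂P := by
          refine integral_congr_ae ?_
          filter_upwards [hI1.prod_left_ae] with ω hω
          exact (integral_inner hω (X u ω)).symm
        rw [h2, ← integral_integral_swap (f := fun r ω => inner ℝ (X u ω) (X r ω)) (by exact hIu)]
        exact hB u hu
    _ = T * B := by simp [hμ, hT]

end TimeIntegral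

/-! ### Second moments of the Langevin diffusion -/

section Moments

variable {Ω : Type*} [MeasurableSpace Ω] {P : Measure Ω} {d : ℕ}
  {W : ℝ≥0 → Ω → EuclideanSpace ℝ (Fin d)}

theorem IsBrownian.ae_continuous (hW : IsBrownian P W) :
    ∀ᵐ ω ∂P, Continuous fun t => W t ω := by
  have h : ∀ᵐ ω ∂P, ∀ k, Continuous fun t => W t ω k :=
    ae_all_iff.2 fun k => (hW.coord k).cont
  filter_upwards [h] with ω hω
  exact (PiLp.continuous_toLp 2 _).comp (continuous_pi hω)

theorem IsBrownian.integral_norm_sq (hW : IsBrownian P W) (t : ℝ≥0) :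
    Integrable (fun ω => ‖W t ω‖ ^ 2) P ∧ ∫ ω, ‖W t ω‖ ^ 2 ∂P = d * t := by
  have hB := fun k => (hW.coord k).toIsPreBrownianReal
  have hi : ∀ k, Integrable (fun ω => W t ω k ^ 2) P := fun k =>
    ((hB k).hasLaw_eval t).hasGaussianLaw.memLp_two.integrable_sq
  have he : ∀ k, ∫ ω, W t ω k ^ 2 ∂P = t := fun k => by
    have h1 := (hB k).covariance_fun_eval t t
    have h2 := (hB k).integral_eval t
    simp only [covariance, h2, sub_zero, min_self] at h1
    simpa only [sq] using h1
  have hn : ∀ ω, ‖W t ω‖ ^ 2 = ∑ k, W t ω k ^ 2 := fun ω => EuclideanSpace.real_norm_sq_eq _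
  simp_rw [hn]
  refine ⟨integrable_finsetSum _ fun k _ => hi k, ?_⟩
  rw [integral_finsetSum _ fun k _ => hi k]
  simp [he]

theorem IsSolution.aestronglyMeasurable {F : ℝ≥0 → MeasurableSpace Ω}
    {b : ℝ≥0 → Ω → EuclideanSpace ℝ (Fin d) → EuclideanSpace ℝ (Fin d)}
    {x₀ : EuclideanSpace ℝ (Fin d)} {X : ℝ≥0 → Ω → EuclideanSpace ℝ (Fin d)}
    (hX : IsSolution P W F b x₀ X) (hF : ∀ t, F t ≤ ‹MeasurableSpace Ω›) (t : ℝ≥0) :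
    AEStronglyMeasurable (X t) P :=
  (hX.adapted t).mono (hF t)

theorem one_add_sq_mul_exp_le (x : ℝ) (hx : 0 ≤ x) :
    1 + (x * Real.exp x) ^ 2 ≤ Real.exp (4 * x) := by
  have h1 : Real.exp (4 * x) = Real.exp x ^ 2 * Real.exp x ^ 2 := by
    rw [← Real.exp_nat_mul, ← Real.exp_add]; congr 1; push_cast; ring
  rw [h1, mul_pow]
  have h2 : x + 1 ≤ Real.exp x := Real.add_one_le_exp x
  have h3 : (x + 1) ^ 2 ≤ Real.exp x ^ 2 := pow_le_pow_left₀ (by linarith) h2 2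
  nlinarith [mul_nonneg hx hx, sq_nonneg (Real.exp x)]

/-- Linear growth of the drift and Grönwall's inequality bound the path of a solution by the noise
path, hence its second moment by that of Brownian motion, without stochastic calculus. -/
theorem IsSolution.integral_norm_sq_le [IsProbabilityMeasure P] {F : ℝ≥0 → MeasurableSpace Ω}
    {b : EuclideanSpace ℝ (Fin d) → EuclideanSpace ℝ (Fin d)} {L : ℝ≥0}
    {x₀ : EuclideanSpace ℝ (Fin d)} {X : ℝ≥0 → Ω → EuclideanSpace ℝ (Fin d)}
    (hX : IsSolution P W F (fun _ _ x => -b x) x₀ X) (hW : IsBrownian P W)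
    (hb : LipschitzWith L b) (hF : ∀ t, F t ≤ ‹MeasurableSpace Ω›) (t : ℝ≥0) :
    Integrable (fun ω => ‖X t ω‖ ^ 2) P ∧
      ∫ ω, ‖X t ω‖ ^ 2 ∂P ≤
        6 * (1 + (d : ℝ) + ‖x₀‖ ^ 2 + 2 * ‖b 0‖ ^ 2) * Real.exp ((2 + 4 * L) * t) := by
  set K : ℝ := 1 + (d : ℝ) + ‖x₀‖ ^ 2 + 2 * ‖b 0‖ ^ 2 with hK
  have hK0 : 0 ≤ K := by positivity
  -- `A` majorizes the path apart from the Lipschitz part of the drift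
  let A : ℝ → Ω → ℝ := fun s ω =>
    ‖x₀‖ + s.toNNReal * ‖b 0‖ + √2 * ‖W s.toNNReal ω‖
  have hA0 : ∀ s ω, 0 ≤ A s ω := fun s ω => by positivity
  have hAm : ∀ s, AEStronglyMeasurable (A s) P := fun s =>
    ((hW.measurable s.toNNReal).norm.const_mul _ |>.const_add _).aestronglyMeasurable
  have hAc : ∀ᵐ ω ∂P, Continuous fun s => A s ω := by
    filter_upwards [hW.ae_continuous] with ω hω
    have : Continuous fun s : ℝ => W s.toNNReal ω := hω.comp continuous_real_toNNReal
    fun_prop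
  have hAsq : ∀ s ω, A s ω ^ 2 ≤
      3 * (‖x₀‖ ^ 2 + (s.toNNReal : ℝ) ^ 2 * ‖b 0‖ ^ 2) + 6 * ‖W s.toNNReal ω‖ ^ 2 := by
    intro s ω
    have h2 : (√2 * ‖W s.toNNReal ω‖) ^ 2 = 2 * ‖W s.toNNReal ω‖ ^ 2 := by
      rw [mul_pow, Real.sq_sqrt (by norm_num)]
    have h3 : ∀ p q r : ℝ, (p + q + r) ^ 2 ≤ 3 * (p ^ 2 + q ^ 2 + r ^ 2) := fun p q r => by
      nlinarith [sq_nonneg (p - q), sq_nonneg (p - r), sq_nonneg (q - r)]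
    have h4 := h3 ‖x₀‖ (s.toNNReal * ‖b 0‖) (√2 * ‖W s.toNNReal ω‖)
    rw [h2, mul_pow] at h4
    linarith
  have hWi : ∀ s : ℝ, Integrable (fun ω => 6 * ‖W s.toNNReal ω‖ ^ 2) P := fun s =>
    (hW.integral_norm_sq s.toNNReal).1.const_mul 6
  have hAi : ∀ s, Integrable (fun ω => A s ω ^ 2) P := fun s => by
    refine Integrable.mono' ((integrable_const
      (3 * (‖x₀‖ ^ 2 + (s.toNNReal : ℝ) ^ 2 * ‖b 0‖ ^ 2))).add (hWi s))
      ((hAm s).pow 2) (Eventually.of_forall fun ω => ?_)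
    rw [Real.norm_of_nonneg (sq_nonneg _)]
    exact hAsq s ω
  have hAE : ∀ s, s ≤ (t : ℝ) → ∫ ω, A s ω ^ 2 ∂P ≤ 3 * K * Real.exp (2 * t) := by
    intro s hs
    have h1 : ∫ ω, A s ω ^ 2 ∂P ≤
        3 * (‖x₀‖ ^ 2 + (s.toNNReal : ℝ) ^ 2 * ‖b 0‖ ^ 2) + 6 * (d * s.toNNReal) := by
      refine (integral_mono (hAi s) ((integrable_const _).add (hWi s)) (hAsq s)).trans_eq ?_
      rw [Pi.add_def, integral_add (integrable_const _) (hWi s),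
        integral_const_mul (6 : ℝ), (hW.integral_norm_sq s.toNNReal).2]
      simp
    have hs' : (s.toNNReal : ℝ) ≤ t := by exact_mod_cast Real.toNNReal_le_iff_le_coe.2 hs
    have h0 : (0 : ℝ) ≤ s.toNNReal := NNReal.coe_nonneg _
    have h2 : 1 + 2 * (t : ℝ) + (2 * (t : ℝ)) ^ 2 / 2 ≤ Real.exp (2 * t) :=
      Real.quadratic_le_exp_of_nonneg (by positivity)
    have h3 : (s.toNNReal : ℝ) ^ 2 ≤ (t : ℝ) ^ 2 := pow_le_pow_left₀ h0 hs' 2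
    have h4 : ‖x₀‖ ^ 2 * 1 ≤ ‖x₀‖ ^ 2 * Real.exp (2 * t) := by
      gcongr; nlinarith [t.coe_nonneg]
    have h5 : ‖b 0‖ ^ 2 * (s.toNNReal : ℝ) ^ 2 ≤ ‖b 0‖ ^ 2 * (2 * Real.exp (2 * t)) := by
      gcongr; nlinarith [t.coe_nonneg]
    have h6 : (d : ℝ) * (2 * s.toNNReal) ≤ d * Real.exp (2 * t) := by
      gcongr; nlinarith [t.coe_nonneg]
    rw [hK]
    nlinarith [Real.exp_pos (2 * (t : ℝ))]
  have hrc : ∀ᵐ ω ∂P, ∀ s, ContinuousWithinAt (fun s => A s ω ^ 2) (Set.Ici s) s := by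
    filter_upwards [hAc] with ω hω s using (hω.pow 2).continuousWithinAt
  obtain ⟨hI, hIE⟩ := integral_intervalIntegral_le (P := P) (X := fun s ω => A s ω ^ 2) t.coe_nonneg
    (aestronglyMeasurable_uncurry_of_rightContinuous (fun s => (hAm s).pow 2) hrc _)
    (fun s ω => sq_nonneg _) (fun s _ => hAi s) (fun s hs => hAE s hs.2)
  have hpath : ∀ᵐ ω ∂P, ‖X t ω‖ ^ 2 ≤
      2 * A t ω ^ 2 + 2 * (L * Real.exp (L * t)) ^ 2 * (t * ∫ s in (0 : ℝ)..t, A s ω ^ 2) := by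
    filter_upwards [hX.continuous, hX.equation, hAc] with ω hc he hAω
    have hXc : Continuous fun s : ℝ => X s.toNNReal ω := hc.comp continuous_real_toNNReal
    have hbX : Continuous fun s : ℝ => b (X s.toNNReal ω) := hb.continuous.comp hXc
    have hg : ∀ s ∈ Set.Icc (0 : ℝ) t, ‖X s.toNNReal ω‖ ≤
        A s ω + L * ∫ u in (0 : ℝ)..s, ‖X u.toNNReal ω‖ := by
      intro s hs
      have h1 : ‖∫ u in (0 : ℝ)..s, -b (X u.toNNReal ω)‖ ≤
          s * ‖b 0‖ + L * ∫ u in (0 : ℝ)..s, ‖X u.toNNReal ω‖ := by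
        calc ‖∫ u in (0 : ℝ)..s, -b (X u.toNNReal ω)‖
            ≤ ∫ u in (0 : ℝ)..s, ‖-b (X u.toNNReal ω)‖ :=
              intervalIntegral.norm_integral_le_integral_norm hs.1
          _ ≤ ∫ u in (0 : ℝ)..s, (‖b 0‖ + L * ‖X u.toNNReal ω‖) := by
              refine intervalIntegral.integral_mono_on hs.1
                (hbX.neg.norm.intervalIntegrable _ _)
                ((continuous_const.add (hXc.norm.const_mul _)).intervalIntegrable _ _) ?_
              intro u _
              have h2 := hb.dist_le_mul (X u.toNNReal ω) 0
              rw [dist_eq_norm, dist_zero_right] at h2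
              rw [norm_neg]
              linarith [norm_le_insert' (b (X u.toNNReal ω)) (b 0)]
          _ = s * ‖b 0‖ + L * ∫ u in (0 : ℝ)..s, ‖X u.toNNReal ω‖ := by
              rw [intervalIntegral.integral_add (continuous_const.intervalIntegrable _ _)
                ((hXc.norm.const_mul _).intervalIntegrable _ _),
                intervalIntegral.integral_const_mul]
              simp
      have h3 := he s.toNNReal
      rw [Real.coe_toNNReal s hs.1] at h3
      have h4 : ‖√2 • W s.toNNReal ω‖ = √2 * ‖W s.toNNReal ω‖ := by
        rw [norm_smul, Real.norm_of_nonneg (Real.sqrt_nonneg _)]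
      have h5 : A s ω = ‖x₀‖ + s * ‖b 0‖ + √2 * ‖W s.toNNReal ω‖ := by
        simp only [A, Real.coe_toNNReal s hs.1]
      rw [h5, ← h4]
      conv_lhs => rw [h3]
      exact (norm_add₃_le).trans (by linarith)
    have hG := le_add_mul_integral_of_le_add_integral hXc.norm hAω (fun s => hA0 s ω)
      L.coe_nonneg t.coe_nonneg hg
    simp only [Real.toNNReal_coe] at hG
    have hCS := sq_intervalIntegral_le (f := fun s => A s ω) t.coe_nonneg
      (hAω.intervalIntegrable _ _) ((hAω.pow 2).intervalIntegrable _ _)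
    set I := ∫ s in (0 : ℝ)..t, A s ω
    calc ‖X t ω‖ ^ 2 ≤ (A t ω + L * (Real.exp (L * t) * I)) ^ 2 :=
          pow_le_pow_left₀ (norm_nonneg _) hG 2
      _ ≤ 2 * A t ω ^ 2 + 2 * (L * Real.exp (L * t)) ^ 2 * I ^ 2 := by
          nlinarith [sq_nonneg (A t ω - L * (Real.exp (L * t) * I))]
      _ ≤ _ := by gcongr
  have hbi : Integrable (fun ω => 2 * A t ω ^ 2 +
      2 * (L * Real.exp (L * t)) ^ 2 * (t * ∫ s in (0 : ℝ)..t, A s ω ^ 2)) P :=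
    ((hAi t).const_mul 2).add ((hI.const_mul _).const_mul _)
  have hXi : Integrable (fun ω => ‖X t ω‖ ^ 2) P := by
    refine Integrable.mono' hbi ((hX.aestronglyMeasurable hF t).norm.pow 2) ?_
    filter_upwards [hpath] with ω hω
    rwa [Real.norm_of_nonneg (sq_nonneg _)]
  refine ⟨hXi, (integral_mono_ae hXi hbi hpath).trans ?_⟩
  rw [integral_add ((hAi t).const_mul 2) ((hI.const_mul _).const_mul _), integral_const_mul,
    integral_const_mul, integral_const_mul]
  calc 2 * ∫ ω, A t ω ^ 2 ∂P + 2 * (L * Real.exp (L * t)) ^ 2 *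
        (t * ∫ ω, (∫ s in (0 : ℝ)..t, A s ω ^ 2) ∂P)
      ≤ 2 * (3 * K * Real.exp (2 * t)) + 2 * (L * Real.exp (L * t)) ^ 2 *
        (t * (t * (3 * K * Real.exp (2 * t)))) := by
        gcongr
        exact hAE t le_rfl
    _ = 6 * K * Real.exp (2 * t) * (1 + (L * t * Real.exp (L * t)) ^ 2) := by ring
    _ ≤ 6 * K * Real.exp (2 * t) * Real.exp (4 * (L * t)) := by
        gcongr
        exact one_add_sq_mul_exp_le _ (by positivity)
    _ = 6 * K * Real.exp ((2 + 4 * L) * t) := by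
        rw [mul_assoc, ← Real.exp_add]
        congr 2
        ring

end Moments

/-! ### Decorrelation of the switched field along an independent path -/

section Switching

variable {Ω : Type*} [MeasurableSpace Ω] {P : Measure Ω} {d N : ℕ}
  {W : ℝ≥0 → Ω → EuclideanSpace ℝ (Fin d)} {J : ℝ≥0 → Ω → Fin N}

theorem past_le {E : Type*} [MeasurableSpace E] {X : ℝ≥0 → Ω → E} (hX : ∀ t, Measurable (X t))
    (t : ℝ≥0) : past X t ≤ ‹MeasurableSpace Ω› :=
  iSup_le fun s => (hX s).comap_le

theorem past_le_comap_path {Ω E : Type*} [MeasurableSpace E] (X : ℝ≥0 → Ω → E) (t : ℝ≥0) :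
    past X t ≤ MeasurableSpace.comap (fun ω s => X s ω) inferInstance := by
  refine iSup_le fun s => ?_
  have : X s = (fun x : ℝ≥0 → E => x s) ∘ fun ω s => X s ω := rfl
  rw [this, ← MeasurableSpace.comap_comp]
  exact MeasurableSpace.comap_mono (measurable_pi_apply (s : ℝ≥0)).comap_le

theorem indepFun_of_aestronglyMeasurable_comap_path
    (hWJ : IndepFun (fun ω t => W t ω) (fun ω t => J t ω) P) {X Y : Ω → ℝ}
    (hX : AEStronglyMeasurable[MeasurableSpace.comap (fun ω t => W t ω) inferInstance] X P)
    (hY : Measurable[MeasurableSpace.comap (fun ω t => J t ω) inferInstance] Y) :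
    IndepFun Y X P := by
  have h1 : IndepFun Y (hX.mk X) P := by
    rw [IndepFun_iff_Indep]
    exact indep_of_indep_of_le_right (indep_of_indep_of_le_left
      ((IndepFun_iff_Indep _ _ _).1 hWJ).symm hY.comap_le)
      hX.stronglyMeasurable_mk.measurable.comap_le
  exact h1.congr (EventuallyEq.refl _ _) hX.ae_eq_mk.symm

theorem norm_inner_le_half {E : Type*} [NormedAddCommGroup E] [InnerProductSpace ℝ E] (x y : E) :
    ‖inner ℝ x y‖ ≤ (‖x‖ ^ 2 + ‖y‖ ^ 2) / 2 := by
  have := norm_inner_le_norm (𝕜 := ℝ) x y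
  nlinarith [sq_nonneg (‖x‖ - ‖y‖)]

/-- Conditionally on the path of `X`, a mean-zero field switched by the index process decorrelates
at the rate of the spectral gap `N ≥ 1`; no regularity of `X` in time enters. -/
theorem integral_inner_switched_le [IsProbabilityMeasure P] [NeZero N]
    (hW : ∀ t, Measurable (W t)) (hJ : IsIndexProcess P J)
    (hWJ : IndepFun (fun ω t => W t ω) (fun ω t => J t ω) P)
    {f : Fin N → EuclideanSpace ℝ (Fin d) → EuclideanSpace ℝ (Fin d)}
    (hf : ∀ a, Continuous (f a)) (hsum : ∀ x, ∑ a, f a x = 0)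
    {X : ℝ≥0 → Ω → EuclideanSpace ℝ (Fin d)} (hX : ∀ t, AEStronglyMeasurable[past W t] (X t) P)
    {r u : ℝ≥0} {C : ℝ}
    (hr : ∀ a, Integrable (fun ω => ‖f a (X r ω)‖ ^ 2) P ∧ ∫ ω, ‖f a (X r ω)‖ ^ 2 ∂P ≤ C)
    (hu : ∀ a, Integrable (fun ω => ‖f a (X u ω)‖ ^ 2) P ∧ ∫ ω, ‖f a (X u ω)‖ ^ 2 ∂P ≤ C)
    {p q : ℝ≥0} (hpq : p ≤ q) :
    ∫ ω, inner ℝ (f (J q ω) (X u ω)) (f (J p ω) (X r ω)) ∂P ≤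
      C * Real.exp (-((q : ℝ) - p)) := by
  have hC : 0 ≤ C := (integral_nonneg fun ω => sq_nonneg _).trans (hr 0).2
  -- `S a b` is an event of `J` alone, and `G a b` below a functional of `W` alone
  let S : Fin N → Fin N → Set Ω := fun a b => J p ⁻¹' {a} ∩ J q ⁻¹' {b}
  have hS : ∀ a b, MeasurableSet (S a b) := fun a b =>
    (hJ.measurable p (measurableSet_singleton a)).inter
      (hJ.measurable q (measurableSet_singleton b))
  have hSJ : ∀ a b,
      MeasurableSet[MeasurableSpace.comap (fun ω t => J t ω) inferInstance] (S a b) := by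
    intro a b
    refine ⟨{x | x p = a} ∩ {x | x q = b}, ?_, rfl⟩
    exact (measurableSet_eq_fun (measurable_pi_apply p) measurable_const).inter
      (measurableSet_eq_fun (measurable_pi_apply q) measurable_const)
  let G : Fin N → Fin N → Ω → ℝ := fun a b ω => inner ℝ (f b (X u ω)) (f a (X r ω))
  have hGW : ∀ a b,
      AEStronglyMeasurable[MeasurableSpace.comap (fun ω t => W t ω) inferInstance] (G a b) P :=
    fun a b => ((hf b).comp_aestronglyMeasurable ((hX u).mono (past_le_comap_path W u))).inner
      ((hf a).comp_aestronglyMeasurable ((hX r).mono (past_le_comap_path W r)))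
  have hWle : MeasurableSpace.comap (fun ω t => W t ω) inferInstance ≤ ‹MeasurableSpace Ω› :=
    (measurable_pi_lambda _ hW).comap_le
  have hGb : ∀ a b ω, ‖G a b ω‖ ≤ (‖f b (X u ω)‖ ^ 2 + ‖f a (X r ω)‖ ^ 2) / 2 := fun a b ω =>
    norm_inner_le_half _ _
  have hGbi : ∀ a b, Integrable (fun ω => (‖f b (X u ω)‖ ^ 2 + ‖f a (X r ω)‖ ^ 2) / 2) P :=
    fun a b => ((hu b).1.add (hr a).1).div_const 2
  have hGi : ∀ a b, Integrable (G a b) P := fun a b =>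
    Integrable.mono' (hGbi a b) ((hGW a b).mono hWle) (Eventually.of_forall (hGb a b))
  have hGC : ∀ a, ∫ ω, G a a ω ∂P ≤ C := by
    intro a
    calc ∫ ω, G a a ω ∂P ≤ ∫ ω, (‖f a (X u ω)‖ ^ 2 + ‖f a (X r ω)‖ ^ 2) / 2 ∂P :=
          integral_mono (hGi a a) (hGbi a a) fun ω => (le_abs_self _).trans (hGb a a ω)
      _ = ((∫ ω, ‖f a (X u ω)‖ ^ 2 ∂P) + ∫ ω, ‖f a (X r ω)‖ ^ 2 ∂P) / 2 := by
          rw [integral_div, integral_add (hu a).1 (hr a).1]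
      _ ≤ C := by linarith [(hu a).2, (hr a).2]
  have hGsum : ∀ a, ∑ b, ∫ ω, G a b ω ∂P = 0 := by
    intro a
    rw [← integral_finsetSum _ fun b _ => hGi a b]
    simp only [G, ← sum_inner, hsum, inner_zero_left, integral_zero]
  have hdecomp : ∀ ω, inner ℝ (f (J q ω) (X u ω)) (f (J p ω) (X r ω)) =
      ∑ a, ∑ b, (S a b).indicator (1 : Ω → ℝ) ω * G a b ω := by
    intro ω
    rw [Finset.sum_eq_single (J p ω), Finset.sum_eq_single (J q ω)]
    · simp [S, G]
    · intro b _ hb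
      simp [S, hb.symm]
    · simp
    · intro a _ ha
      simp [S, ha.symm]
    · simp
  have hind : ∀ a b, IndepFun ((S a b).indicator (1 : Ω → ℝ)) (G a b) P := fun a b =>
    indepFun_of_aestronglyMeasurable_comap_path hWJ (hGW a b)
      (Measurable.indicator measurable_const (hSJ a b))
  have hSi : ∀ a b, Integrable ((S a b).indicator (1 : Ω → ℝ)) P := fun a b =>
    (integrable_const (1 : ℝ)).indicator (hS a b)
  have hprod : ∀ a b, Integrable (fun ω => (S a b).indicator (1 : Ω → ℝ) ω * G a b ω) P :=
    fun a b => (hind a b).integrable_mul (hSi a b) (hGi a b)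
  have hint : ∀ a b, ∫ ω, (S a b).indicator (1 : Ω → ℝ) ω * G a b ω ∂P =
      P.real (J p ⁻¹' {a}) * (NormedSpace.exp (((q - p : ℝ≥0) : ℝ) • rateMatrix N) a b *
        ∫ ω, G a b ω ∂P) := by
    intro a b
    rw [(hind a b).integral_fun_mul_eq_mul_integral (hSi a b).aestronglyMeasurable
      (hGi a b).aestronglyMeasurable, integral_indicator_one (hS a b), ← mul_assoc]
    have := hJ.markov p (q - p) Set.univ MeasurableSet.univ a b
    rw [Set.univ_inter, add_tsub_cancel_of_le hpq] at this
    rw [this]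
  simp_rw [hdecomp]
  rw [integral_finsetSum _ fun a _ => integrable_finsetSum _ fun b _ => hprod a b]
  have hrow : ∀ a, ∫ ω, ∑ b, (S a b).indicator (1 : Ω → ℝ) ω * G a b ω ∂P ≤
      P.real (J p ⁻¹' {a}) * (C * Real.exp (-((q : ℝ) - p))) := by
    intro a
    rw [integral_finsetSum _ fun b _ => hprod a b]
    simp_rw [hint a, ← Finset.mul_sum]
    rw [sum_exp_rateMatrix_mul (hGsum a), NNReal.coe_sub hpq, mul_comm C]
    have hN : (1 : ℝ) ≤ N := by exact_mod_cast NeZero.one_le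
    have hqp : (0 : ℝ) ≤ q - p := sub_nonneg.2 (by exact_mod_cast hpq)
    have he : Real.exp (-(N : ℝ) * ((q : ℝ) - p)) ≤ Real.exp (-((q : ℝ) - p)) :=
      Real.exp_le_exp.2 (by nlinarith)
    refine mul_le_mul_of_nonneg_left ?_ measureReal_nonneg
    exact (mul_le_mul_of_nonneg_left (hGC a) (Real.exp_pos _).le).trans
      (mul_le_mul_of_nonneg_right he hC)
  refine (Finset.sum_le_sum fun a _ => hrow a).trans_eq ?_
  have h1 : ∑ a, P.real (J p ⁻¹' {a}) = 1 := by
    rw [sum_measureReal_preimage_singleton _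
      fun a _ => hJ.measurable p (measurableSet_singleton a)]
    simp
  rw [← Finset.sum_mul, h1, one_mul]

/-- The time-changed switched field `s ↦ f (J (s / η)) (X s)`, extended to `s < 0` by its value
at `0`. -/
noncomputable def switched {E : Type*} (f : Fin N → E → E) (J : ℝ≥0 → Ω → Fin N) (η : ℝ≥0)
    (X : ℝ≥0 → Ω → E) (s : ℝ) (ω : Ω) : E :=
  f (J (s.toNNReal / η) ω) (X s.toNNReal ω)

section Paths

variable {E : Type*} [NormedAddCommGroup E] {f : Fin N → E → E} {X : ℝ≥0 → Ω → E}

theorem aestronglyMeasurable_switched (hJ : IsIndexProcess P J) (hf : ∀ a, Continuous (f a))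
    (hX : ∀ t, AEStronglyMeasurable (X t) P) (η : ℝ≥0) (s : ℝ) :
    AEStronglyMeasurable (switched f J η X s) P := by
  have hc : Continuous fun x : Fin N × E => f x.1 x.2 := continuous_prod_of_discrete_left.2 hf
  exact hc.comp_aestronglyMeasurable
    ((hJ.measurable _).stronglyMeasurable.aestronglyMeasurable.prodMk (hX _))

theorem aestronglyMeasurable_uncurry_switched [SFinite P] (hJ : IsIndexProcess P J)
    (hf : ∀ a, Continuous (f a)) (hX : ∀ t, AEStronglyMeasurable (X t) P)
    (hXc : ∀ᵐ ω ∂P, Continuous fun t => X t ω) (η : ℝ≥0) (μ : Measure ℝ) [SFinite μ] :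
    AEStronglyMeasurable (fun p : ℝ × Ω => switched f J η X p.1 p.2) (μ.prod P) := by
  refine aestronglyMeasurable_uncurry_of_rightContinuous
    (aestronglyMeasurable_switched hJ hf hX η) ?_ μ
  have hc : Continuous fun x : Fin N × E => f x.1 x.2 := continuous_prod_of_discrete_left.2 hf
  filter_upwards [hJ.rightContinuous, hXc] with ω hω hXω s
  have h1 : ContinuousWithinAt (fun s : ℝ => s.toNNReal / η) (Set.Ici s) s :=
    (continuous_real_toNNReal.div_const η).continuousWithinAt
  have h2 : Set.MapsTo (fun s : ℝ => s.toNNReal / η) (Set.Ici s) (Set.Ici (s.toNNReal / η)) := by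
    intro r hr
    exact div_le_div_of_nonneg_right (Real.toNNReal_le_toNNReal hr) zero_le
  have h3 : ContinuousWithinAt (fun s : ℝ => J (s.toNNReal / η) ω) (Set.Ici s) s :=
    ContinuousWithinAt.comp (f := fun s : ℝ => s.toNNReal / η) (hω (s.toNNReal / η)) h1 h2
  exact hc.continuousAt.comp_continuousWithinAt
    (h3.prodMk (hXω.comp continuous_real_toNNReal).continuousWithinAt)

theorem ae_intervalIntegrable_switched [SFinite P] (hJ : IsIndexProcess P J)
    (hf : ∀ a, Continuous (f a)) (hX : ∀ t, AEStronglyMeasurable (X t) P)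
    (hXc : ∀ᵐ ω ∂P, Continuous fun t => X t ω) (η : ℝ≥0) :
    ∀ᵐ ω ∂P, ∀ a b, IntervalIntegrable (fun s => switched f J η X s ω) volume a b := by
  have hm := (aestronglyMeasurable_uncurry_switched hJ hf hX hXc η volume).prod_swap.prodMk_left
  filter_upwards [hm, hXc] with ω hω hXω a b
  have hb : Continuous fun s : ℝ => ∑ i, ‖f i (X s.toNNReal ω)‖ :=
    continuous_finsetSum _ fun i _ => ((hf i).comp (hXω.comp continuous_real_toNNReal)).norm
  refine (hb.intervalIntegrable a b).mono_fun hω.restrict (Eventually.of_forall fun s => ?_)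
  refine le_trans ?_ (Real.le_norm_self _)
  exact Finset.single_le_sum (f := fun i => ‖f i (X s.toNNReal ω)‖) (fun i _ => norm_nonneg _)
    (Finset.mem_univ (J (s.toNNReal / η) ω))

end Paths

end Switching

/-! ### The averaging error along the Langevin path -/

section Averaging

variable {Ω : Type*} [MeasurableSpace Ω] {P : Measure Ω} [IsProbabilityMeasure P] {d N : ℕ}
  {W : ℝ≥0 → Ω → EuclideanSpace ℝ (Fin d)} {J : ℝ≥0 → Ω → Fin N}

/-- No integrability of the smaller function is needed: its integral is `0` otherwise. -/
theorem intervalIntegral_le_of_le_of_nonneg {f g : ℝ → ℝ} {T : ℝ} (hT : 0 ≤ T)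
    (hg : IntervalIntegrable g volume 0 T) (h0 : ∀ s ∈ Set.Icc 0 T, 0 ≤ g s)
    (h : ∀ s ∈ Set.Icc 0 T, f s ≤ g s) :
    ∫ s in (0 : ℝ)..T, f s ≤ ∫ s in (0 : ℝ)..T, g s := by
  by_cases hf : IntervalIntegrable f volume 0 T
  · exact intervalIntegral.integral_mono_on hT hf hg h
  · rw [intervalIntegral.integral_undef hf]
    exact intervalIntegral.integral_nonneg hT h0

theorem integral_norm_sq_comp_le {X : Ω → EuclideanSpace ℝ (Fin d)}
    {f : EuclideanSpace ℝ (Fin d) → EuclideanSpace ℝ (Fin d)} (hf : Continuous f)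
    (hX : AEStronglyMeasurable X P) {L G M : ℝ} (hL : 0 ≤ L) (hG : 0 ≤ G) (hM : 1 ≤ M)
    (hgrowth : ∀ x, ‖f x‖ ≤ 2 * (L * ‖x‖ + G))
    (hXi : Integrable (fun ω => ‖X ω‖ ^ 2) P) (hXM : ∫ ω, ‖X ω‖ ^ 2 ∂P ≤ M) :
    Integrable (fun ω => ‖f (X ω)‖ ^ 2) P ∧ ∫ ω, ‖f (X ω)‖ ^ 2 ∂P ≤ 4 * (L + G) ^ 2 * M := by
  -- Cauchy–Schwarz with weights `L` and `G`: `(L x + G)² ≤ (L + G) (L x² + G)`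
  have hb : ∀ ω, ‖f (X ω)‖ ^ 2 ≤ 4 * (L + G) * (L * ‖X ω‖ ^ 2 + G) := by
    intro ω
    have h1 := pow_le_pow_left₀ (norm_nonneg _) (hgrowth (X ω)) 2
    nlinarith [mul_nonneg (mul_nonneg hL hG) (sq_nonneg (‖X ω‖ - 1))]
  have hbi : Integrable (fun ω => 4 * (L + G) * (L * ‖X ω‖ ^ 2 + G)) P :=
    ((hXi.const_mul L).add (integrable_const G)).const_mul _
  have hi : Integrable (fun ω => ‖f (X ω)‖ ^ 2) P := by
    refine hbi.mono' ((hf.comp_aestronglyMeasurable hX).norm.pow 2)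
      (Eventually.of_forall fun ω => ?_)
    rw [Real.norm_of_nonneg (sq_nonneg _)]
    exact hb ω
  refine ⟨hi, (integral_mono hi hbi hb).trans ?_⟩
  rw [integral_const_mul, integral_add (hXi.const_mul L) (integrable_const G), integral_const_mul]
  simp only [integral_const, probReal_univ, one_smul]
  calc 4 * (L + G) * (L * ∫ ω, ‖X ω‖ ^ 2 ∂P + G) ≤ 4 * (L + G) * (L * M + G * M) := by
        gcongr
        exact le_mul_of_one_le_right hG hM
    _ = 4 * (L + G) ^ 2 * M := by ring

variable [NeZero N]

/-- The time average of a mean-zero field switched at speed `1 / η` is small in mean square. The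
bound `T` in the minimum is the trivial one, which takes over for large `η`. -/
theorem integral_norm_sq_integral_switched_le
    (hW : ∀ t, Measurable (W t)) (hJ : IsIndexProcess P J)
    (hWJ : IndepFun (fun ω t => W t ω) (fun ω t => J t ω) P)
    {f : Fin N → EuclideanSpace ℝ (Fin d) → EuclideanSpace ℝ (Fin d)}
    (hf : ∀ a, Continuous (f a)) (hsum : ∀ x, ∑ a, f a x = 0)
    {X : ℝ≥0 → Ω → EuclideanSpace ℝ (Fin d)} (hX : ∀ t, AEStronglyMeasurable[past W t] (X t) P)
    (hXc : ∀ᵐ ω ∂P, Continuous fun t => X t ω) {η : ℝ≥0} (hη : 0 < η) {T : ℝ≥0} {C : ℝ}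
    (hC : ∀ a, ∀ s ≤ T, Integrable (fun ω => ‖f a (X s ω)‖ ^ 2) P ∧
      ∫ ω, ‖f a (X s ω)‖ ^ 2 ∂P ≤ C) :
    Integrable (fun ω => ‖∫ s in (0 : ℝ)..T, switched f J η X s ω‖ ^ 2) P ∧
      ∫ ω, ‖∫ s in (0 : ℝ)..T, switched f J η X s ω‖ ^ 2 ∂P ≤ T * (C * min (2 * (η : ℝ)) (T : ℝ)) := by
  have hC0 : 0 ≤ C := (integral_nonneg fun ω => sq_nonneg _).trans (hC 0 0 zero_le).2
  have hη' : (0 : ℝ) < η := hη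
  have hXm : ∀ t, AEStronglyMeasurable (X t) P := fun t => (hX t).mono (past_le hW t)
  have hsT : ∀ s ∈ Set.Icc (0 : ℝ) T, s.toNNReal ≤ T := fun s hs =>
    Real.toNNReal_le_iff_le_coe.2 hs.2
  have hYb : ∀ s ω, ‖switched f J η X s ω‖ ^ 2 ≤ ∑ a, ‖f a (X s.toNNReal ω)‖ ^ 2 := fun s ω =>
    Finset.single_le_sum (f := fun a => ‖f a (X s.toNNReal ω)‖ ^ 2) (fun a _ => sq_nonneg _)
      (Finset.mem_univ (J (s.toNNReal / η) ω))
  have hbi : ∀ s ∈ Set.Icc (0 : ℝ) T,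
      Integrable (fun ω => ∑ a, ‖f a (X s.toNNReal ω)‖ ^ 2) P := fun s hs =>
    integrable_finsetSum _ fun a _ => (hC a _ (hsT s hs)).1
  have hYm := aestronglyMeasurable_switched hJ hf hXm η
  have hY2 : ∀ s ∈ Set.Icc (0 : ℝ) T, Integrable (fun ω => ‖switched f J η X s ω‖ ^ 2) P := by
    intro s hs
    refine (hbi s hs).mono' ((hYm s).norm.pow 2) (Eventually.of_forall fun ω => ?_)
    rw [Real.norm_of_nonneg (sq_nonneg _)]
    exact hYb s ω
  have hcorr : ∀ u ∈ Set.Icc (0 : ℝ) T, ∀ r ∈ Set.Icc (0 : ℝ) T,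
      ∫ ω, inner ℝ (switched f J η X u ω) (switched f J η X r ω) ∂P ≤
        C * Real.exp (-((η : ℝ)⁻¹ * |u - r|)) := by
    have key : ∀ u ∈ Set.Icc (0 : ℝ) T, ∀ r ∈ Set.Icc (0 : ℝ) T, r ≤ u →
        ∫ ω, inner ℝ (switched f J η X u ω) (switched f J η X r ω) ∂P ≤
          C * Real.exp (-((η : ℝ)⁻¹ * |u - r|)) := by
      intro u hu r hr hru
      have h1 := integral_inner_switched_le hW hJ hWJ hf hsum hX
        (fun a => hC a _ (hsT r hr)) (fun a => hC a _ (hsT u hu))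
        (div_le_div_of_nonneg_right (Real.toNNReal_le_toNNReal hru) (zero_le (a := η)))
      refine h1.trans_eq ?_
      rw [NNReal.coe_div, NNReal.coe_div, Real.coe_toNNReal u hu.1, Real.coe_toNNReal r hr.1,
        abs_of_nonneg (sub_nonneg.2 hru), ← sub_div, div_eq_inv_mul]
    intro u hu r hr
    rcases le_total r u with hru | hur
    · exact key u hu r hr hru
    · rw [abs_sub_comm]
      simp_rw [real_inner_comm (switched f J η X r _)]
      exact key r hr u hu hur
  refine integral_norm_sq_intervalIntegral_le (C := ∑ _a : Fin N, C) T.coe_nonneg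
    (aestronglyMeasurable_uncurry_switched hJ hf hXm hXc η _) ?_ ?_ ?_
  · intro s hs
    rw [← integrable_norm_rpow_iff (hYm s) two_ne_zero ENNReal.ofNat_ne_top]
    simpa using hY2 s (Set.Ioc_subset_Icc_self hs)
  · intro s hs
    have hs' := Set.Ioc_subset_Icc_self hs
    refine (integral_mono (hY2 s hs') (hbi s hs') (hYb s)).trans ?_
    rw [integral_finsetSum _ fun a _ => (hC a _ (hsT s hs')).1]
    exact Finset.sum_le_sum fun a _ => (hC a _ (hsT s hs')).2
  · intro u hu
    have hu' := Set.Ioc_subset_Icc_self hu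
    have hec : Continuous fun r : ℝ => Real.exp (-((η : ℝ)⁻¹ * |u - r|)) := by fun_prop
    have h1 : ∫ r in (0 : ℝ)..T, (∫ ω, inner ℝ (switched f J η X u ω) (switched f J η X r ω) ∂P) ≤
        C * ∫ r in (0 : ℝ)..T, Real.exp (-((η : ℝ)⁻¹ * |u - r|)) := by
      rw [← intervalIntegral.integral_const_mul]
      exact intervalIntegral_le_of_le_of_nonneg T.coe_nonneg
        ((hec.const_mul C).intervalIntegrable _ _)
        (fun r _ => by positivity) (hcorr u hu')
    refine h1.trans (mul_le_mul_of_nonneg_left (le_min ?_ ?_) hC0)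
    · refine (intervalIntegral_exp_neg_abs_sub_le (inv_pos.2 hη') T.coe_nonneg u).trans_eq ?_
      rw [div_inv_eq_mul]
    · calc ∫ r in (0 : ℝ)..T, Real.exp (-((η : ℝ)⁻¹ * |u - r|)) ≤ ∫ _ in (0 : ℝ)..T, (1 : ℝ) := by
            refine intervalIntegral.integral_mono_on T.coe_nonneg (hec.intervalIntegrable _ _)
              (continuous_const.intervalIntegrable _ _) fun r _ => ?_
            exact Real.exp_le_one_iff.2 (neg_nonpos.2 (by positivity))
        _ = T := by simp

/-- Interpolation between the regimes of small and large `η` in terms of `h = η ^ (1 / 4)`. The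
factor `6 κ exp ((2 + 4 L) T)` is the second moment bound of `IsSolution.integral_norm_sq_le`. -/
theorem mul_min_le_sq {T h M κ L : ℝ} (hT : 0 ≤ T) (hh : 0 < h) (hκ : 0 ≤ κ) :
    T * (4 * M ^ 2 * (6 * κ * Real.exp ((2 + 4 * L) * T)) * min (2 * h ^ 4) T) ≤
      (8 * √κ * M * Real.exp ((2 + 2 * L) * T) * h) ^ 2 := by
  have h1 : (8 * √κ * M * Real.exp ((2 + 2 * L) * T) * h) ^ 2 =
      64 * (κ * M ^ 2) * Real.exp ((2 + 4 * L) * T) * (Real.exp T ^ 2 * h ^ 2) := by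
    have h2 : Real.exp ((2 + 2 * L) * T) ^ 2 = Real.exp ((2 + 4 * L) * T) * Real.exp T ^ 2 := by
      rw [← Real.exp_nat_mul, ← Real.exp_nat_mul, ← Real.exp_add]
      congr 1
      push_cast
      ring
    calc _ = 64 * √κ ^ 2 * M ^ 2 * Real.exp ((2 + 2 * L) * T) ^ 2 * h ^ 2 := by ring
      _ = _ := by rw [Real.sq_sqrt hκ, h2]; ring
  have hTe : T + 1 ≤ Real.exp T := Real.add_one_le_exp T
  have hmin : T * min (2 * h ^ 4) T ≤ 2 * (Real.exp T ^ 2 * h ^ 2) := by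
    rcases le_total h 1 with h1 | h1
    · have h2 : h ^ 4 ≤ h ^ 2 := pow_le_pow_of_le_one hh.le h1 (by norm_num)
      calc T * min (2 * h ^ 4) T ≤ Real.exp T ^ 2 * (2 * h ^ 2) :=
            mul_le_mul (by nlinarith) ((min_le_left _ _).trans (by linarith))
              (le_min (by positivity) hT) (by positivity)
        _ = _ := by ring
    · have h2 : 1 ≤ h ^ 2 := one_le_pow₀ h1
      calc T * min (2 * h ^ 4) T ≤ T * T := by gcongr; exact min_le_right _ _
        _ ≤ 2 * (Real.exp T ^ 2 * 1) := by nlinarith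
        _ ≤ _ := by gcongr
  rw [h1]
  calc _ = 24 * (κ * M ^ 2) * Real.exp ((2 + 4 * L) * T) * (T * min (2 * h ^ 4) T) := by ring
    _ ≤ 24 * (κ * M ^ 2) * Real.exp ((2 + 4 * L) * T) * (2 * (Real.exp T ^ 2 * h ^ 2)) := by
        gcongr
    _ = 48 * ((κ * M ^ 2) * Real.exp ((2 + 4 * L) * T) * (Real.exp T ^ 2 * h ^ 2)) := by ring
    _ ≤ 64 * ((κ * M ^ 2) * Real.exp ((2 + 4 * L) * T) * (Real.exp T ^ 2 * h ^ 2)) := by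
        gcongr
        norm_num
    _ = _ := by ring

theorem integral_norm_le_of_integral_sq_le {E : Type*} [NormedAddCommGroup E] {R : Ω → E}
    (hm : AEStronglyMeasurable R P) (hi : Integrable (fun ω => ‖R ω‖ ^ 2) P) {c : ℝ} (hc : 0 < c)
    (h : ∫ ω, ‖R ω‖ ^ 2 ∂P ≤ c ^ 2) :
    Integrable (fun ω => ‖R ω‖) P ∧ ∫ ω, ‖R ω‖ ∂P ≤ c := by
  have hb : ∀ ω, ‖R ω‖ ≤ (2 * c)⁻¹ * (‖R ω‖ ^ 2 + c ^ 2) := fun ω => by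
    rw [← div_eq_inv_mul, le_div_iff₀ (by positivity)]
    nlinarith [sq_nonneg (‖R ω‖ - c)]
  have hbi : Integrable (fun ω => (2 * c)⁻¹ * (‖R ω‖ ^ 2 + c ^ 2)) P :=
    (hi.add (integrable_const _)).const_mul _
  have hRi : Integrable (fun ω => ‖R ω‖) P := by
    refine hbi.mono' hm.norm (Eventually.of_forall fun ω => ?_)
    rw [norm_norm]
    exact hb ω
  refine ⟨hRi, (integral_mono hRi hbi hb).trans ?_⟩
  rw [integral_const_mul, integral_add hi (integrable_const _), ← div_eq_inv_mul,
    div_le_iff₀ (by positivity)]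
  simp only [integral_const, probReal_univ, one_smul]
  nlinarith

theorem one_add_mul_exp_le (x : ℝ) (hx : 0 ≤ x) : 1 + x * Real.exp x ≤ Real.exp (2 * x) := by
  have h1 : Real.exp (2 * x) = Real.exp x * Real.exp x := by
    rw [← Real.exp_add]; congr 1; ring
  rw [h1]
  nlinarith [Real.add_one_le_exp x]

end Averaging

/-! ### Comparison of the two diffusions -/

section Comparison

variable {Ω : Type*} [MeasurableSpace Ω] {P : Measure Ω} [IsProbabilityMeasure P] {d N : ℕ}
  {W : ℝ≥0 → Ω → EuclideanSpace ℝ (Fin d)} {J : ℝ≥0 → Ω → Fin N}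

/-- The averaging estimate for general Lipschitz drifts `g a` with mean `b`. -/
theorem integral_norm_sub_le [NeZero N] {L : ℝ≥0} {G : ℝ}
    {g : Fin N → EuclideanSpace ℝ (Fin d) → EuclideanSpace ℝ (Fin d)}
    {b : EuclideanSpace ℝ (Fin d) → EuclideanSpace ℝ (Fin d)}
    (hg : ∀ a, LipschitzWith L (g a)) (hb : LipschitzWith L b)
    (hgG : ∀ a, ‖g a 0‖ ≤ G) (hbG : ‖b 0‖ ≤ G) (hsum : ∀ x, ∑ a, (g a x - b x) = 0)
    (hW : IsBrownian P W) (hJ : IsIndexProcess P J)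
    (hWJ : IndepFun (fun ω t => W t ω) (fun ω t => J t ω) P) {x₀ : EuclideanSpace ℝ (Fin d)}
    {ζ θ : ℝ≥0 → Ω → EuclideanSpace ℝ (Fin d)} {η : ℝ≥0} (hη : 0 < η)
    (hζ : IsSolution P W (fun t => past W t) (fun _ _ x => -b x) x₀ ζ)
    (hθ : IsSolution P W (fun t => past W t ⊔ past J (t / η))
      (fun t ω x => -g (J (t / η) ω) x) x₀ θ) (t : ℝ≥0) :
    Integrable (fun ω => ‖θ t ω - ζ t ω‖) P ∧
      ∫ ω, ‖θ t ω - ζ t ω‖ ∂P ≤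
        errorConst d L ‖x₀‖ ‖b 0‖ G * Real.exp (8 * (1 + L) * t) * (η : ℝ) ^ (1 / 4 : ℝ) := by
  have hη' : (0 : ℝ) < η := hη
  have hG : 0 ≤ G := (norm_nonneg _).trans hbG
  set κ : ℝ := 1 + (d : ℝ) + ‖x₀‖ ^ 2 + 2 * ‖b 0‖ ^ 2 with hκ
  have hκ1 : 1 ≤ κ := by rw [hκ]; nlinarith [sq_nonneg ‖x₀‖, sq_nonneg ‖b 0‖, d.cast_nonneg (α := ℝ)]
  set h : ℝ := (η : ℝ) ^ (1 / 4 : ℝ) with hh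
  have hh0 : 0 < h := Real.rpow_pos_of_pos hη' _
  have hh4 : h ^ 4 = η := by
    rw [hh, ← Real.rpow_natCast, ← Real.rpow_mul hη'.le]
    norm_num
  let f : Fin N → EuclideanSpace ℝ (Fin d) → EuclideanSpace ℝ (Fin d) := fun a x => g a x - b x
  have hfc : ∀ a, Continuous (f a) := fun a => (hg a).continuous.sub hb.continuous
  have hgrow : ∀ c : EuclideanSpace ℝ (Fin d) → EuclideanSpace ℝ (Fin d), LipschitzWith L c →
      ‖c 0‖ ≤ G → ∀ x, ‖c x‖ ≤ L * ‖x‖ + G := by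
    intro c hc hcG x
    have h1 := hc.dist_le_mul x 0
    rw [dist_eq_norm, dist_zero_right] at h1
    linarith [norm_le_insert' (c x) (c 0)]
  have hfgrow : ∀ a x, ‖f a x‖ ≤ 2 * (L * ‖x‖ + G) := fun a x =>
    (norm_sub_le _ _).trans (by linarith [hgrow (g a) (hg a) (hgG a) x, hgrow b hb hbG x])
  have hζm := hζ.aestronglyMeasurable (past_le hW.measurable)
  have hθm := hθ.aestronglyMeasurable fun s =>
    sup_le (past_le hW.measurable s) (past_le hJ.measurable _)
  let R : ℝ≥0 → Ω → EuclideanSpace ℝ (Fin d) := fun s ω =>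
    ∫ u in (0 : ℝ)..s, switched f J η ζ u ω
  let c : ℝ := 8 * √κ * (1 + L + G) * Real.exp ((2 + 2 * L) * t) * h
  -- `1 + L + G` instead of `L + G` keeps `c` positive when the gradients vanish
  have hc0 : 0 < c := by positivity
  have hRm : ∀ s, AEStronglyMeasurable (R s) P := by
    intro s
    have h1 := (aestronglyMeasurable_uncurry_switched hJ hfc hζm hζ.continuous η
      (volume.restrict (Set.Ioc 0 (s : ℝ)))).prod_swap.integral_prod_right'
    simp only [R, intervalIntegral.integral_of_le s.coe_nonneg]
    exact h1
  have hR : ∀ s ≤ t, Integrable (fun ω => ‖R s ω‖) P ∧ ∫ ω, ‖R s ω‖ ∂P ≤ c := by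
    intro s hst
    have h1 := integral_norm_sq_integral_switched_le hW.measurable hJ hWJ hfc hsum hζ.adapted
      hζ.continuous hη (T := s) (C := 4 * (1 + L + G) ^ 2 *
        (6 * κ * Real.exp ((2 + 4 * L) * s))) ?_
    · refine integral_norm_le_of_integral_sq_le (hRm s) h1.1 hc0 (h1.2.trans ?_)
      rw [← hh4]
      refine (mul_min_le_sq s.coe_nonneg hh0 (by positivity)).trans ?_
      have : (s : ℝ) ≤ t := by exact_mod_cast hst
      simp only [c]
      gcongr
    · intro a u hu
      have h2 := hζ.integral_norm_sq_le hW hb (past_le hW.measurable) u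
      have hu' : (u : ℝ) ≤ s := by exact_mod_cast hu
      have h3 := integral_norm_sq_comp_le (M := 6 * κ * Real.exp ((2 + 4 * L) * s)) (hfc a) (hζm u)
        L.coe_nonneg hG ?_ (hfgrow a) h2.1 (h2.2.trans (by gcongr))
      · refine ⟨h3.1, h3.2.trans ?_⟩
        gcongr
        linarith
      · have : 1 ≤ Real.exp ((2 + 4 * L) * (s : ℝ)) := Real.one_le_exp (by positivity)
        nlinarith
  have hYint := ae_intervalIntegrable_switched hJ hfc hζm hζ.continuous η
  have hRc : ∀ᵐ ω ∂P, Continuous fun s : ℝ => ‖R s.toNNReal ω‖ := by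
    filter_upwards [hYint] with ω hω
    exact ((intervalIntegral.continuous_primitive hω 0).comp
      (NNReal.continuous_coe.comp continuous_real_toNNReal)).norm
  obtain ⟨hIi, hIE⟩ := integral_intervalIntegral_le (P := P)
    (X := fun s ω => ‖R s.toNNReal ω‖) t.coe_nonneg
    (aestronglyMeasurable_uncurry_of_rightContinuous (fun s => (hRm s.toNNReal).norm)
      (hRc.mono fun ω hω s => hω.continuousWithinAt) _)
    (fun s ω => norm_nonneg _) (fun s hs => (hR _ (Real.toNNReal_le_iff_le_coe.2 hs.2)).1)
    (fun s hs => (hR _ (Real.toNNReal_le_iff_le_coe.2 hs.2)).2)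
  have hpath : ∀ᵐ ω ∂P, ‖θ t ω - ζ t ω‖ ≤
      ‖R t ω‖ + L * (Real.exp (L * t) * ∫ s in (0 : ℝ)..t, ‖R s.toNNReal ω‖) := by
    filter_upwards [hζ.continuous, hθ.continuous, hζ.equation, hθ.equation, hRc, hYint,
      ae_intervalIntegrable_switched hJ (fun a => (hg a).continuous) hθm hθ.continuous η]
      with ω hζc hθc hζe hθe hRω hYω hθω
    have hζc' : Continuous fun s : ℝ => ζ s.toNNReal ω := hζc.comp continuous_real_toNNReal
    have hθc' : Continuous fun s : ℝ => θ s.toNNReal ω := hθc.comp continuous_real_toNNReal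
    have hD : Continuous fun s : ℝ => ‖θ s.toNNReal ω - ζ s.toNNReal ω‖ := (hθc'.sub hζc').norm
    have hbζ : Continuous fun s : ℝ => b (ζ s.toNNReal ω) := hb.continuous.comp hζc'
    have hmain : ∀ s ∈ Set.Icc (0 : ℝ) t, ‖θ s.toNNReal ω - ζ s.toNNReal ω‖ ≤
        ‖R s.toNNReal ω‖ + L * ∫ u in (0 : ℝ)..s, ‖θ u.toNNReal ω - ζ u.toNNReal ω‖ := by
      intro s hs
      have h1 := hθe s.toNNReal
      have h2 := hζe s.toNNReal
      rw [Real.coe_toNNReal s hs.1] at h1 h2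
      have hIθ : IntervalIntegrable (fun u => switched g J η θ u ω) volume 0 s := hθω 0 s
      have hIb : IntervalIntegrable (fun u : ℝ => b (ζ u.toNNReal ω)) volume 0 s :=
        hbζ.intervalIntegrable _ _
      have hIY : IntervalIntegrable (fun u => switched f J η ζ u ω) volume 0 s := hYω 0 s
      have h3 : θ s.toNNReal ω - ζ s.toNNReal ω =
          -(∫ u in (0 : ℝ)..s, (switched g J η θ u ω - b (ζ u.toNNReal ω) -
            switched f J η ζ u ω)) - R s.toNNReal ω := by
        rw [intervalIntegral.integral_sub (hIθ.sub hIb) hIY,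
          intervalIntegral.integral_sub hIθ hIb, h1, h2, intervalIntegral.integral_neg,
          intervalIntegral.integral_neg]
        simp only [R, Real.coe_toNNReal s hs.1, switched]
        abel
      have h4 : ‖∫ u in (0 : ℝ)..s, (switched g J η θ u ω - b (ζ u.toNNReal ω) -
          switched f J η ζ u ω)‖ ≤
          L * ∫ u in (0 : ℝ)..s, ‖θ u.toNNReal ω - ζ u.toNNReal ω‖ := by
        rw [← intervalIntegral.integral_const_mul]
        refine intervalIntegral.norm_integral_le_of_norm_le hs.1 (Eventually.of_forall fun u _ => ?_)
          ((hD.const_mul _).intervalIntegrable _ _)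
        have h5 := (hg (J (u.toNNReal / η) ω)).dist_le_mul (θ u.toNNReal ω) (ζ u.toNNReal ω)
        rw [dist_eq_norm, dist_eq_norm] at h5
        have h6 : switched g J η θ u ω - b (ζ u.toNNReal ω) - switched f J η ζ u ω =
            g (J (u.toNNReal / η) ω) (θ u.toNNReal ω) - g (J (u.toNNReal / η) ω) (ζ u.toNNReal ω) := by
          simp only [switched, f]
          abel
        rwa [h6]
      rw [h3]
      refine (norm_sub_le _ _).trans ?_
      rw [norm_neg]
      linarith
    have hG := le_add_mul_integral_of_le_add_integral hD hRω (fun s => norm_nonneg _)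
      L.coe_nonneg t.coe_nonneg hmain
    simpa only [Real.toNNReal_coe] using hG
  have hbi : Integrable (fun ω => ‖R t ω‖ +
      L * (Real.exp (L * t) * ∫ s in (0 : ℝ)..t, ‖R s.toNNReal ω‖)) P :=
    (hR t le_rfl).1.add ((hIi.const_mul _).const_mul _)
  have hDi : Integrable (fun ω => ‖θ t ω - ζ t ω‖) P := by
    refine hbi.mono' ((hθm t).sub (hζm t)).norm ?_
    filter_upwards [hpath] with ω hω
    rwa [norm_norm]
  refine ⟨hDi, (integral_mono_ae hDi hbi hpath).trans ?_⟩
  rw [integral_add (hR t le_rfl).1 ((hIi.const_mul _).const_mul _), integral_const_mul,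
    integral_const_mul]
  calc ∫ ω, ‖R t ω‖ ∂P + L * (Real.exp (L * t) * ∫ ω, (∫ s in (0 : ℝ)..t, ‖R s.toNNReal ω‖) ∂P)
      ≤ c + L * (Real.exp (L * t) * (t * c)) := by
        gcongr
        exact (hR t le_rfl).2
    _ = c * (1 + L * t * Real.exp (L * t)) := by ring
    _ ≤ c * Real.exp (2 * (L * t)) := by
        gcongr
        exact one_add_mul_exp_le _ (by positivity)
    _ = 8 * √κ * (1 + L + G) * (Real.exp ((2 + 2 * L) * t) * Real.exp (2 * (L * t))) * h := by
        simp only [c]; ring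
    _ ≤ 8 * √κ * (1 + L + G) * Real.exp (8 * (1 + L) * t) * h := by
        rw [← Real.exp_add]
        gcongr
        nlinarith [mul_nonneg L.coe_nonneg t.coe_nonneg, t.coe_nonneg]

/-! ### Potentials and their constants -/

theorem gradient_meanPotential {Φ : Fin N → EuclideanSpace ℝ (Fin d) → ℝ}
    (hΦ : ∀ i, Differentiable ℝ (Φ i)) (x : EuclideanSpace ℝ (Fin d)) :
    gradient (meanPotential Φ) x = (1 / (N : ℝ)) • ∑ i, gradient (Φ i) x := by
  refine HasGradientAt.gradient ?_
  rw [hasGradientAt_iff_hasFDerivAt, map_smul, map_sum]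
  exact (HasFDerivAt.fun_sum fun i _ => ((hΦ i x).hasGradientAt).hasFDerivAt).const_mul (1 / (N : ℝ))

theorem norm_inv_smul_sum_le [NeZero N] {E : Type*} [NormedAddCommGroup E] [NormedSpace ℝ E] {v : Fin N → E}
    {C : ℝ} (h : ∀ i, ‖v i‖ ≤ C) : ‖(1 / (N : ℝ)) • ∑ i, v i‖ ≤ C := by
  have hN : (0 : ℝ) < N := by exact_mod_cast NeZero.pos N
  rw [norm_smul, Real.norm_of_nonneg (by positivity), one_div, ← div_eq_inv_mul,
    div_le_iff₀ hN]
  refine (norm_sum_le_of_le _ fun i _ => h i).trans_eq ?_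
  simp [mul_comm]

theorem isTheta_errorConst {L r g G : ℝ} (hL : 0 ≤ L) (hG : 0 ≤ G) :
    (fun n : ℕ => errorConst n L r g G) =Θ[atTop] fun n : ℕ => √(n : ℝ) := by
  have hc : 0 < 8 * (1 + L + G) := by positivity
  have h1 : (fun n : ℕ => √(1 + (n : ℝ) + r ^ 2 + 2 * g ^ 2)) =Θ[atTop]
      fun n : ℕ => √(n : ℝ) := by
    constructor
    · refine Asymptotics.IsBigO.of_bound (√(2 + r ^ 2 + 2 * g ^ 2)) ?_
      filter_upwards [eventually_ge_atTop 1] with n hn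
      have hn' : (1 : ℝ) ≤ n := by exact_mod_cast hn
      rw [Real.norm_of_nonneg (Real.sqrt_nonneg _), Real.norm_of_nonneg (Real.sqrt_nonneg _),
        ← Real.sqrt_mul (by positivity)]
      refine Real.sqrt_le_sqrt ?_
      nlinarith [sq_nonneg r, sq_nonneg g]
    · refine Asymptotics.IsBigO.of_bound 1 (Eventually.of_forall fun n => ?_)
      rw [Real.norm_of_nonneg (Real.sqrt_nonneg _), Real.norm_of_nonneg (Real.sqrt_nonneg _),
        one_mul]
      refine Real.sqrt_le_sqrt ?_
      nlinarith [sq_nonneg r, sq_nonneg g]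
  have h2 : (fun n : ℕ => errorConst n L r g G) =
      fun n : ℕ => 8 * (1 + L + G) * √(1 + (n : ℝ) + r ^ 2 + 2 * g ^ 2) := by
    funext n
    rw [errorConst]
    ring
  rw [h2]
  exact h1.const_mul_left hc.ne'

end Comparison

end SGLDiff

theorem theorem1 {Ω : Type*} [MeasurableSpace Ω] (P : Measure Ω) [IsProbabilityMeasure P]
    (d N : ℕ) [NeZero N]
    (Φ : Fin N → EuclideanSpace ℝ (Fin d) → ℝ) (L : ℝ≥0)
    (hΦ : ∀ i, ContDiff ℝ 1 (Φ i))
    (hL : ∀ i, LipschitzWith L (gradient (Φ i)))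
    (W : ℝ≥0 → Ω → EuclideanSpace ℝ (Fin d)) (hW : SGLDiff.IsBrownian P W)
    (J : ℝ≥0 → Ω → Fin N) (hJ : SGLDiff.IsIndexProcess P J)
    (hWJ : IndepFun (fun ω t => W t ω) (fun ω t => J t ω) P)
    (x₀ : EuclideanSpace ℝ (Fin d))
    (ζ : ℝ≥0 → Ω → EuclideanSpace ℝ (Fin d)) (hζ : SGLDiff.IsLangevin P Φ W x₀ ζ) :
    -- the quantitative bound, for every learning rate and every time
    (∀ η : ℝ≥0, 0 < η → ∀ θ : ℝ≥0 → Ω → EuclideanSpace ℝ (Fin d),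
      SGLDiff.IsSGLDiff P Φ W J η x₀ θ → ∀ t : ℝ≥0,
        Integrable (fun ω => ‖θ t ω - ζ t ω‖) P ∧
        ∫ ω, ‖θ t ω - ζ t ω‖ ∂P ≤
          SGLDiff.errorConst d L ‖x₀‖ ‖gradient (SGLDiff.meanPotential Φ) 0‖
              (⨆ i, ‖gradient (Φ i) 0‖) *
            Real.exp (8 * (1 + L) * t) * (η : ℝ) ^ (1 / 4 : ℝ)) ∧
    -- the constant is of exact order `√n` in the dimension `n`, the other quantities being fixed
    ((fun n : ℕ => SGLDiff.errorConst n L ‖x₀‖ ‖gradient (SGLDiff.meanPotential Φ) 0‖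
        (⨆ i, ‖gradient (Φ i) 0‖)) =Θ[atTop] fun n : ℕ => √(n : ℝ)) ∧
    -- strong convergence at each fixed time as `η ↓ 0`
    (∀ θ : ℝ≥0 → ℝ≥0 → Ω → EuclideanSpace ℝ (Fin d),
      (∀ η : ℝ≥0, 0 < η → SGLDiff.IsSGLDiff P Φ W J η x₀ (θ η)) →
        ∀ t : ℝ≥0, Tendsto (fun η : ℝ≥0 => ∫ ω, ‖θ η t ω - ζ t ω‖ ∂P) (𝓝[>] 0) (𝓝 0)) := by
  have hgrad := SGLDiff.gradient_meanPotential fun i => (hΦ i).differentiable one_ne_zero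
  have hG : ∀ i, ‖gradient (Φ i) 0‖ ≤ ⨆ i, ‖gradient (Φ i) 0‖ := fun i =>
    le_ciSup (Set.finite_range fun i => ‖gradient (Φ i) 0‖).bddAbove i
  have hmeanL : LipschitzWith L (gradient (SGLDiff.meanPotential Φ)) := by
    refine LipschitzWith.of_dist_le_mul fun x y => ?_
    rw [dist_eq_norm, hgrad, hgrad, ← smul_sub, ← Finset.sum_sub_distrib]
    refine SGLDiff.norm_inv_smul_sum_le fun i => ?_
    rw [← dist_eq_norm]
    exact (hL i).dist_le_mul x y
  have hmeanG : ‖gradient (SGLDiff.meanPotential Φ) 0‖ ≤ ⨆ i, ‖gradient (Φ i) 0‖ := by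
    rw [hgrad]
    exact SGLDiff.norm_inv_smul_sum_le hG
  have hsum : ∀ x, ∑ i, (gradient (Φ i) x - gradient (SGLDiff.meanPotential Φ) x) = 0 := by
    intro x
    have hN : (N : ℝ) ≠ 0 := NeZero.ne _
    rw [Finset.sum_sub_distrib, hgrad, Finset.sum_const, Finset.card_univ, Fintype.card_fin,
      ← Nat.cast_smul_eq_nsmul ℝ, smul_smul, mul_one_div_cancel hN, one_smul, sub_self]
  have hbound := fun (η : ℝ≥0) (hη : 0 < η) (θ : ℝ≥0 → Ω → EuclideanSpace ℝ (Fin d))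
    (hθ : SGLDiff.IsSGLDiff P Φ W J η x₀ θ) (t : ℝ≥0) =>
    SGLDiff.integral_norm_sub_le hL hmeanL hG hmeanG hsum hW hJ hWJ hη hζ hθ t
  refine ⟨hbound, SGLDiff.isTheta_errorConst L.coe_nonneg ((norm_nonneg _).trans hmeanG), ?_⟩
  intro θ hθ t
  have hlim : Tendsto (fun η : ℝ≥0 =>
      SGLDiff.errorConst d L ‖x₀‖ ‖gradient (SGLDiff.meanPotential Φ) 0‖
        (⨆ i, ‖gradient (Φ i) 0‖) * Real.exp (8 * (1 + L) * t) * (η : ℝ) ^ (1 / 4 : ℝ))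
      (𝓝[>] 0) (𝓝 0) := by
    have h1 : Continuous fun η : ℝ≥0 => (η : ℝ) ^ (1 / 4 : ℝ) :=
      (Real.continuous_rpow_const (by norm_num)).comp NNReal.continuous_coe
    have h2 := ((h1.tendsto 0).mono_left (nhdsWithin_le_nhds (s := Set.Ioi 0))).const_mul
      (SGLDiff.errorConst d L ‖x₀‖ ‖gradient (SGLDiff.meanPotential Φ) 0‖
        (⨆ i, ‖gradient (Φ i) 0‖) * Real.exp (8 * (1 + L) * t))
    simpa [Real.zero_rpow] using h2
  refine squeeze_zero' (Eventually.of_forall fun η => integral_nonneg fun ω => norm_nonneg _) ?_ hlim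
  filter_upwards [self_mem_nhdsWithin] with η hη
  exact (hbound η hη (θ η) (hθ η hη) t).2
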